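/- Let $S=\{0,1,\dots\}^M$, and let $R$ and $\bar R$ be discrete-time random walks on $S$ with transition matrices $P$ and $\bar P$ that allow only nearest-neighbour transitions, i.e. $P(n,n')>0$ or $\bar P(n,n')>0$ only if $n'-n\in\{-1,0,1\}^M$. Assume that each of $R$ and $\bar R$ has a single absorbing communicating class, that is, a communicating class that cannot be left and in which the walk is eventually absorbed with probability one from every starting state (the classes of $R$ and $\bar R$ may differ, and the states outside the class are transient; the irreducible case, where the class is all of $S$, is included). Let $\pi$ and $\bar\pi$ be stationary probability distributions of $R$ and $\bar R$, let $F,\bar F,G:S\to[0,\infty)$, and put $$\mathcal F=\sum_{n\in S}\pi(n)F(n),\qquad \bar{\mathcal F}=\sum_{n\in S}\bar\pi(n)\bar F(n)\qquad(\text{values in }[0,\infty]).$$ For $t=0,1,2,\dots$ let $$F^t(n)=\sum_{k=0}^{t-1}\sum_{m\in S}P^k(n,m)F(m),\qquad D^t(n,n')=F^t(n')-F^t(n),$$ where $P^k(n,m)$ is the $k$-step transition probability of $R$. Suppose that $$\Bigl|\bar F(n)-F(n)+\sum_{n'\in S}\bigl(\bar P(n,n')-P(n,n')\bigr)D^t(n,n')\Bigr|\le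 G(n)\qquad\text{for all }n\in S,\ t\ge 0.$$ Then $$\bigl|\bar{\mathcal F}-\mathcal F\bigr|\le\sum_{n\in S}\bar\pi(n)G(n).$$ Here the inequality means $\bar{\mathcal F}\le\mathcal F+\sum_n\bar\pi(n)G(n)$ and $\mathcal F\le\bar{\mathcal F}+\sum_n\bar\pi(n)G(n)$ in $[0,\infty]$; in particular, if $\sum_n\bar\pi(n)G(n)<\infty$, then $\mathcal F$ is finite if and only if $\bar{\mathcal F}$ is, and in that case the inequality holds between real numbers. -/

import Mathlib

open Filter Topology
open scoped ENNReal NNReal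

/-- The state space `S = {0, 1, …}^M`. -/
abbrev Orthant (M : ℕ) : Type := Fin M → ℕ

noncomputable section

namespace RandomWalk

variable {M : ℕ}

/-- Only transitions to nearest neighbours are allowed: `P n n' > 0` only if
`n' - n ∈ {-1, 0, 1}^M`. The transition matrix of a random walk is given by its rows `P n`,
each of which is a probability distribution on `S`. -/
def NearestNeighbour (P : Orthant M → PMF (Orthant M)) : Prop :=
  ∀ n n' : Orthant M, 0 < P n n' → ∀ i, |(n' i : ℤ) - (n i : ℤ)| ≤ 1

/-- The `k`-step transition probabilities: `step P k n m` is `P^k(n, m)`. -/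
def step (P : Orthant M → PMF (Orthant M)) : ℕ → Orthant M → PMF (Orthant M)
  | 0, n => PMF.pure n
  | k + 1, n => (P n).bind (step P k)

/-- `π` is a stationary probability distribution: the balance equations hold. -/
def IsStationary (P : Orthant M → PMF (Orthant M)) (π : PMF (Orthant M)) : Prop :=
  ∀ n, π n * ∑' n', P n n' = ∑' n', π n' * P n' n

/-- `C` is a communicating class that cannot be left and by which the walk is eventually
absorbed with probability one, whatever its starting state. As `C` cannot be left,
`∑' m : C, P^k(n, m)` is the probability that the walk started in `n` has entered `C` by
time `k`. The states outside `C` are then transient, and `C` is the only closed class. -/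
structure IsAbsorbingClass (P : Orthant M → PMF (Orthant M)) (C : Set (Orthant M)) : Prop where
  closed : ∀ n ∈ C, ∀ n', 0 < P n n' → n' ∈ C
  communicating : ∀ n ∈ C, ∀ m ∈ C, ∃ k, 0 < step P k n m
  absorbing : ∀ n, Tendsto (fun k => ∑' m : C, step P k n (m : Orthant M)) atTop (𝓝 1)

/-- The walk has a single absorbing communicating class (`C = S` is the irreducible case). -/
def HasSingleAbsorbingClass (P : Orthant M → PMF (Orthant M)) : Prop :=
  ∃ C, IsAbsorbingClass P C

/-- The stationary performance measure `∑ n, π(n) F(n)`, with values in `[0, ∞]`. -/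
def performance (π : PMF (Orthant M)) (F : Orthant M → ℝ≥0) : ℝ≥0∞ :=
  ∑' n, π n * (F n : ℝ≥0∞)

/-- The expected cumulative reward `F^t(n)` up to time `t` for the walk started in `n`. For
nearest-neighbour walks the sums over the states have finitely many nonzero terms. -/
def cumulativeReward (P : Orthant M → PMF (Orthant M)) (F : Orthant M → ℝ≥0)
    (t : ℕ) (n : Orthant M) : ℝ :=
  ∑ k ∈ Finset.range t, ∑' m, (step P k n m).toReal * (F m : ℝ)

/-- The bias terms `D^t(n, n') = F^t(n') - F^t(n)`. -/
def bias (P : Orthant M → PMF (Orthant M)) (F : Orthant M → ℝ≥0)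
    (t : ℕ) (n n' : Orthant M) : ℝ :=
  cumulativeReward P F t n' - cumulativeReward P F t n

end RandomWalk

end

/-!
Write `F^t`, `F̄^t` and `G^t` for the cumulative rewards, the last two of them collected by the
perturbed walk. The rows of `P` and `P̄` have total mass one, so the hypothesis says precisely that
`F^t` satisfies the reward recursion of the perturbed walk, `F̄^(t+1) = F̄ + P̄ F̄^t`, up to an error
`G` (`defect_bounds`). Iterating gives `|F̄^t - F^t| ≤ G^t` pointwise (`le_totalReward_add`,
`totalReward_le_add`), and the theorem follows by dividing by `t` and letting `t → ∞`.

The time averages of a nonnegative, possibly unbounded, reward are controlled as follows.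
* A superharmonic function `h ≥ 0` is minimal on the absorbing class
  (`IsAbsorbingClass.superharmonic_le`): stationarity makes `h ∧ K` harmonic on the support of the
  stationary distribution, hence `h` constant on the class, and the walk is absorbed by the class.
* So bounded harmonic functions are constant, and the time averages of a bounded reward
  converge to its stationary mean from every state, because all their subsequential limits are
  harmonic (`IsAbsorbingClass.tendsto_of_bounded`).
* By truncation, the lower limit of the time averages of any reward is at least the stationary
  mean, from every state (`IsAbsorbingClass.expect_le_liminf`); from a state in the support of the
  stationary distribution they converge to it, if it is finite
  (`IsAbsorbingClass.tendsto_of_ne_zero`).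

Evaluated at a state `a` in the support of `π̄`, this yields `𝓕 ≤ 𝓕̄ + ∑ n, π̄(n) G(n)` directly.
For the opposite inequality the difficulty is that `a` may be transient for the unperturbed walk,
from where `F^t / t` need not converge to `𝓕`. However, `P̄ F^t ≤ F^(t+1) + G`, so that by Fatou's
lemma `liminf F^t / t` is superharmonic for the perturbed walk (`expect_liminf_div_le`). It is
therefore minimal on the absorbing class of that walk, and thus at `a` at most its value `𝓕` on
the support of `π`.
-/

namespace RandomWalk

/-! ### Expectations in `[0, ∞]` -/

section Expectation

variable {α : Type*}

/-- The expectation `∑ m, p(m) h(m)` of a nonnegative function, with values in `[0, ∞]`. -/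
noncomputable def expect (p : PMF α) (h : α → ℝ≥0∞) : ℝ≥0∞ :=
  ∑' m, p m * h m

lemma expect_mono (p : PMF α) {g h : α → ℝ≥0∞} (hgh : ∀ m, g m ≤ h m) :
    expect p g ≤ expect p h :=
  ENNReal.tsum_le_tsum fun m => mul_le_mul_right (hgh m) _

lemma expect_add (p : PMF α) (g h : α → ℝ≥0∞) :
    expect p (fun m => g m + h m) = expect p g + expect p h := by
  simp only [expect, mul_add, ENNReal.tsum_add]

lemma expect_const (p : PMF α) (c : ℝ≥0∞) : expect p (fun _ => c) = c := by
  simp only [expect, ENNReal.tsum_mul_right, p.tsum_coe, one_mul]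

lemma expect_div (p : PMF α) (h : α → ℝ≥0∞) (c : ℝ≥0∞) :
    expect p (fun m => h m / c) = expect p h / c := by
  simp only [expect, div_eq_mul_inv, ← mul_assoc, ENNReal.tsum_mul_right]

lemma expect_pure (n : α) (h : α → ℝ≥0∞) : expect (PMF.pure n) h = h n := by
  unfold expect
  rw [tsum_eq_single n]
  · simp
  · intro m hm
    simp [PMF.pure_apply, hm]

lemma expect_bind (p : PMF α) (q : α → PMF α) (h : α → ℝ≥0∞) :
    expect (p.bind q) h = expect p (fun n => expect (q n) h) := by
  simp only [expect, PMF.bind_apply, ← ENNReal.tsum_mul_left, ← ENNReal.tsum_mul_right]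
  rw [ENNReal.tsum_comm]
  simp only [mul_assoc]

lemma expect_sum (p : PMF α) {ι : Type*} (s : Finset ι) (h : ι → α → ℝ≥0∞) :
    expect p (fun m => ∑ i ∈ s, h i m) = ∑ i ∈ s, expect p (h i) := by
  classical
  induction s using Finset.induction_on with
  | empty => simpa using expect_const p 0
  | insert i s hi ih => simp only [Finset.sum_insert hi, expect_add, ih]

lemma expect_eq_lintegral [MeasurableSpace α] [MeasurableSingletonClass α] (p : PMF α)
    (h : α → ℝ≥0∞) : expect p h = ∫⁻ m, p m * h m ∂MeasureTheory.Measure.count :=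
  (MeasureTheory.lintegral_count _).symm

/-- Fatou's lemma. -/
lemma tsum_liminf_le (f : ℕ → α → ℝ≥0∞) :
    ∑' m, liminf (fun t => f t m) atTop ≤ liminf (fun t => ∑' m, f t m) atTop := by
  let _ : MeasurableSpace α := ⊤
  simp only [← MeasureTheory.lintegral_count]
  exact MeasureTheory.lintegral_liminf_le fun _ => measurable_from_top

lemma expect_liminf_le (p : PMF α) (h : ℕ → α → ℝ≥0∞) :
    expect p (fun m => liminf (fun t => h t m) atTop) ≤
      liminf (fun t => expect p (h t)) atTop := by
  refine le_trans (le_of_eq ?_) (tsum_liminf_le fun t m => p m * h t m)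
  exact tsum_congr fun m => (ENNReal.liminf_const_mul_of_ne_top (p.apply_ne_top m)).symm

/-- Bounded convergence. -/
lemma tendsto_expect_of_bounded (p : PMF α) {h : ℕ → α → ℝ≥0∞} {g : α → ℝ≥0∞} {K : ℝ≥0∞}
    (hK : K ≠ ∞) (hbound : ∀ t m, h t m ≤ K)
    (hlim : ∀ m, Tendsto (fun t => h t m) atTop (𝓝 (g m))) :
    Tendsto (fun t => expect p (h t)) atTop (𝓝 (expect p g)) := by
  let _ : MeasurableSpace α := ⊤
  simp only [expect_eq_lintegral]
  refine MeasureTheory.tendsto_lintegral_of_dominated_convergence (fun m => p m * K)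
    (fun _ => measurable_from_top) (fun t => MeasureTheory.ae_of_all _ fun m => ?_) ?_
    (MeasureTheory.ae_of_all _ fun m => ENNReal.Tendsto.const_mul (hlim m) (Or.inr (p.apply_ne_top m)))
  · exact mul_le_mul_right (hbound t m) _
  · rw [← expect_eq_lintegral, expect_const]
    exact hK

/-- Two functions that are ordered and have the same finite expectation agree where `p` is
positive. -/
lemma eq_of_expect_le {p : PMF α} {g h : α → ℝ≥0∞} (hgh : ∀ m, g m ≤ h m)
    (hfin : expect p g ≠ ∞) (hle : expect p h ≤ expect p g) {n : α} (hn : p n ≠ 0) :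
    g n = h n := by
  refine le_antisymm (hgh n) ?_
  by_contra hlt
  refine absurd hle (not_le.2 ?_)
  refine ENNReal.tsum_lt_tsum hfin (fun m => mul_le_mul_right (hgh m) _) (i := n) ?_
  exact ENNReal.mul_lt_mul_right hn (p.apply_ne_top n) (not_le.1 hlt)

end Expectation

/-! ### Stationary distributions and absorbing classes -/

variable {M : ℕ} {P P' : Orthant M → PMF (Orthant M)} {π : PMF (Orthant M)}

lemma expect_step_succ (k : ℕ) (n : Orthant M) (h : Orthant M → ℝ≥0∞) :
    expect (step P (k + 1) n) h = expect (P n) (fun l => expect (step P k l) h) :=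
  expect_bind _ _ _

lemma IsStationary.bind_eq (hπ : IsStationary P π) : π.bind P = π := by
  ext n
  rw [PMF.bind_apply, ← hπ n, PMF.tsum_coe, mul_one]

lemma IsStationary.expect_eq (hπ : IsStationary P π) (h : Orthant M → ℝ≥0∞) :
    expect π (fun n => expect (P n) h) = expect π h := by
  rw [← expect_bind, hπ.bind_eq]

lemma IsStationary.bind_step_eq (hπ : IsStationary P π) (k : ℕ) : π.bind (step P k) = π := by
  induction k with
  | zero => exact PMF.bind_pure π
  | succ k ih =>
    calc π.bind (step P (k + 1)) = (π.bind P).bind (step P k) := (PMF.bind_bind _ _ _).symm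
      _ = π := by rw [hπ.bind_eq, ih]

lemma IsStationary.expect_step_eq (hπ : IsStationary P π) (k : ℕ) (h : Orthant M → ℝ≥0∞) :
    expect π (fun n => expect (step P k n) h) = expect π h := by
  rw [← expect_bind, hπ.bind_step_eq]

lemma IsStationary.ne_zero_of_step (hπ : IsStationary P π) {n m : Orthant M} (hn : π n ≠ 0)
    {k : ℕ} (h : step P k n m ≠ 0) : π m ≠ 0 := by
  rw [← PMF.mem_support_iff, ← hπ.bind_step_eq k, PMF.mem_support_bind_iff]
  exact ⟨n, hn, h⟩

/-- A stationary distribution charges the absorbing class. -/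
lemma IsAbsorbingClass.exists_mem_ne_zero {C : Set (Orthant M)} (hC : IsAbsorbingClass P C)
    (hπ : IsStationary P π) : ∃ a ∈ C, π a ≠ 0 := by
  obtain ⟨n, hn⟩ := π.support_nonempty
  obtain ⟨k, hk⟩ := ((hC.absorbing n).eventually_ne one_ne_zero).exists
  obtain ⟨m, hm⟩ : ∃ m : C, step P k n m ≠ 0 := by
    by_contra! hzero
    exact hk (ENNReal.tsum_eq_zero.2 hzero)
  exact ⟨m, m.2, hπ.ne_zero_of_step hn hm⟩

/-- The maximum principle for a stationary chain: the superlevel sets of a superharmonic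
function are closed under the transitions out of the support of `π`. -/
lemma IsStationary.le_of_transition (hπ : IsStationary P π) {h : Orthant M → ℝ≥0∞}
    (hh : ∀ n, expect (P n) h ≤ h n) {K : ℝ≥0∞} (hK : K ≠ ∞) {n l : Orthant M}
    (hn : π n ≠ 0) (hKn : K ≤ h n) (hl : P n l ≠ 0) : K ≤ h l := by
  have hsuper : ∀ n, expect (P n) (fun m => min (h m) K) ≤ min (h n) K := fun n =>
    le_min ((expect_mono _ fun m => min_le_left _ _).trans (hh n))
      ((expect_mono _ fun m => min_le_right _ _).trans_eq (expect_const _ K))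
  have hfin : ∀ p : PMF (Orthant M), expect p (fun m => min (h m) K) ≠ ∞ := fun p =>
    ne_top_of_le_ne_top hK
      ((expect_mono _ fun m => min_le_right _ _).trans_eq (expect_const _ K))
  -- Stationarity forces the truncation at `K` to be harmonic on the support of `π`;
  -- it attains its maximum `K` at `n`, hence at every successor of `n`.
  have hharm : expect (P n) (fun m => min (h m) K) = min (h n) K := by
    refine eq_of_expect_le (p := π) hsuper ?_ ?_ hn
    · rw [hπ.expect_eq]
      exact hfin π
    · rw [hπ.expect_eq]
  have heq : min (h l) K = K := by
    refine eq_of_expect_le (p := P n) (h := fun _ => K) (fun m => min_le_right _ _) (hfin _) ?_ hl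
    rw [expect_const, hharm, min_eq_right hKn]
  exact min_eq_right_iff.1 heq

lemma IsStationary.le_of_step (hπ : IsStationary P π) {h : Orthant M → ℝ≥0∞}
    (hh : ∀ n, expect (P n) h ≤ h n) {K : ℝ≥0∞} (hK : K ≠ ∞) {k : ℕ} {n m : Orthant M}
    (hn : π n ≠ 0) (hKn : K ≤ h n) (hm : step P k n m ≠ 0) : K ≤ h m := by
  induction k generalizing n with
  | zero =>
    rw [step, ← PMF.mem_support_iff, PMF.mem_support_pure_iff] at hm
    exact hm ▸ hKn
  | succ k ih =>
    rw [step, ← PMF.mem_support_iff, PMF.mem_support_bind_iff] at hm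
    obtain ⟨l, hl, hlm⟩ := hm
    refine ih (n := l) ?_ (hπ.le_of_transition hh hK hn hKn hl) hlm
    rw [← PMF.mem_support_iff, ← hπ.bind_eq, PMF.mem_support_bind_iff]
    exact ⟨n, hn, hl⟩

lemma expect_step_le {h : Orthant M → ℝ≥0∞} (hh : ∀ n, expect (P n) h ≤ h n) (k : ℕ)
    (n : Orthant M) : expect (step P k n) h ≤ h n := by
  induction k generalizing n with
  | zero => simp only [step, expect_pure, le_refl]
  | succ k ih =>
    rw [expect_step_succ]
    exact (expect_mono _ ih).trans (hh n)

/-- In the presence of a stationary distribution, a nonnegative superharmonic function attains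
its minimum over the whole state space at every state of the absorbing class. -/
lemma IsAbsorbingClass.superharmonic_le {C : Set (Orthant M)} (hC : IsAbsorbingClass P C)
    (hπ : IsStationary P π) {h : Orthant M → ℝ≥0∞} (hh : ∀ n, expect (P n) h ≤ h n)
    {a : Orthant M} (ha : a ∈ C) (n : Orthant M) : h a ≤ h n := by
  have hpos : π a ≠ 0 := by
    obtain ⟨b, hb, hπb⟩ := hC.exists_mem_ne_zero hπ
    obtain ⟨k, hk⟩ := hC.communicating b hb a ha
    exact hπ.ne_zero_of_step hπb hk.ne'
  -- It suffices to bound `h n` below by every finite `K ≤ h a`, as `h a` may be infinite.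
  refine ENNReal.le_of_forall_nnreal_lt fun K hKa => ?_
  have hKC : ∀ m : C, (K : ℝ≥0∞) ≤ h m := fun m => by
    obtain ⟨k, hk⟩ := hC.communicating a ha m m.2
    exact hπ.le_of_step hh ENNReal.coe_ne_top hpos hKa.le hk.ne'
  have hlim : Tendsto (fun k => (∑' m : C, step P k n (m : Orthant M)) * K) atTop (𝓝 K) := by
    simpa using ENNReal.Tendsto.mul_const (hC.absorbing n) (Or.inr ENNReal.coe_ne_top)
  refine le_of_tendsto hlim (Eventually.of_forall fun k => ?_)
  calc (∑' m : C, step P k n (m : Orthant M)) * K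
      = ∑' m : C, step P k n (m : Orthant M) * K := ENNReal.tsum_mul_right.symm
    _ ≤ ∑' m : C, step P k n (m : Orthant M) * h m :=
        ENNReal.tsum_le_tsum fun m => mul_le_mul_right (hKC m) _
    _ ≤ expect (step P k n) h :=
        ENNReal.tsum_comp_le_tsum_of_injective Subtype.val_injective _
    _ ≤ h n := expect_step_le hh k n

/-! ### Time averages of rewards -/

/-- The expected cumulative reward `∑ k < t, (P^k F)(n)`, with values in `[0, ∞]`. -/
noncomputable def totalReward (P : Orthant M → PMF (Orthant M)) (F : Orthant M → ℝ≥0∞)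
    (t : ℕ) (n : Orthant M) : ℝ≥0∞ :=
  ∑ k ∈ Finset.range t, expect (step P k n) F

lemma totalReward_succ (F : Orthant M → ℝ≥0∞) (t : ℕ) (n : Orthant M) :
    totalReward P F (t + 1) n = F n + expect (P n) (totalReward P F t) := by
  have h : totalReward P F t = fun l => ∑ k ∈ Finset.range t, expect (step P k l) F := rfl
  rw [h, expect_sum, totalReward, Finset.sum_range_succ', add_comm]
  simp only [expect_step_succ]
  rw [step, expect_pure]

lemma totalReward_succ' (F : Orthant M → ℝ≥0∞) (t : ℕ) (n : Orthant M) :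
    totalReward P F (t + 1) n = totalReward P F t n + expect (step P t n) F :=
  Finset.sum_range_succ _ _

lemma totalReward_mono {F F' : Orthant M → ℝ≥0∞} (h : ∀ n, F n ≤ F' n) (t : ℕ)
    (n : Orthant M) : totalReward P F t n ≤ totalReward P F' t n :=
  Finset.sum_le_sum fun _ _ => expect_mono _ h

lemma IsStationary.expect_totalReward (hπ : IsStationary P π) (F : Orthant M → ℝ≥0∞) (t : ℕ) :
    expect π (totalReward P F t) = t * expect π F := by
  have h : totalReward P F t = fun l => ∑ k ∈ Finset.range t, expect (step P k l) F := rfl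
  rw [h, expect_sum]
  simp only [hπ.expect_step_eq, Finset.sum_const, Finset.card_range, nsmul_eq_mul]

lemma IsStationary.expect_totalReward_div (hπ : IsStationary P π) (F : Orthant M → ℝ≥0∞)
    {t : ℕ} (ht : t ≠ 0) : expect π (fun n => totalReward P F t n / t) = expect π F := by
  rw [expect_div, hπ.expect_totalReward, mul_comm,
    ENNReal.mul_div_cancel_right (Nat.cast_ne_zero.2 ht) (ENNReal.natCast_ne_top t)]

lemma tendsto_div_natCast_zero {u : ℕ → ℝ≥0∞} {K : ℝ≥0∞} (hK : K ≠ ∞) (hu : ∀ t, u t ≤ K) :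
    Tendsto (fun t : ℕ => u t / t) atTop (𝓝 0) := by
  have h : Tendsto (fun t : ℕ => K / (t : ℝ≥0∞)) atTop (𝓝 0) := by
    simpa [div_eq_mul_inv] using
      ENNReal.Tendsto.const_mul ENNReal.tendsto_inv_nat_nhds_zero (Or.inr hK)
  exact tendsto_of_tendsto_of_tendsto_of_le_of_le tendsto_const_nhds h (fun _ => zero_le)
    fun t => ENNReal.div_le_div_right (hu t) _

lemma totalReward_div_le {F : Orthant M → ℝ≥0∞} {K : ℝ≥0∞} (hF : ∀ n, F n ≤ K) (t : ℕ)
    (n : Orthant M) : totalReward P F t n / t ≤ K := by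
  refine ENNReal.div_le_of_le_mul' ?_
  calc totalReward P F t n ≤ ∑ k ∈ Finset.range t, K :=
        Finset.sum_le_sum fun k _ => (expect_mono _ hF).trans_eq (expect_const _ K)
    _ = t * K := by rw [Finset.sum_const, Finset.card_range, nsmul_eq_mul]

/-- Bounded harmonic functions are constant, equal to their stationary mean. -/
lemma IsAbsorbingClass.harmonic_eq {C : Set (Orthant M)} (hC : IsAbsorbingClass P C)
    (hπ : IsStationary P π) {h : Orthant M → ℝ≥0∞} {K : ℝ≥0∞} (hK : K ≠ ∞)
    (hhK : ∀ n, h n ≤ K) (hh : ∀ n, expect (P n) h = h n) (n : Orthant M) :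
    h n = expect π h := by
  have hsub : ∀ n, expect (P n) (fun m => K - h m) ≤ K - h n := fun n => by
    refine ENNReal.le_sub_of_add_le_right (ne_top_of_le_ne_top hK (hhK n)) (le_of_eq ?_)
    rw [← hh n, ← expect_add]
    simp only [tsub_add_cancel_of_le (hhK _), expect_const]
  obtain ⟨a, ha, -⟩ := hC.exists_mem_ne_zero hπ
  have hconst : ∀ n, h n = h a := fun n => by
    refine le_antisymm ?_ (hC.superharmonic_le hπ (fun n => (hh n).le) ha n)
    exact (ENNReal.sub_le_sub_iff_left (hhK n) hK).1 (hC.superharmonic_le hπ hsub ha n)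
  rw [hconst n, ← expect_const π (h a)]
  exact congrArg (expect π) (funext fun m => (hconst m).symm)

/-- The ergodic theorem for bounded rewards, from every starting state. A pointwise limit of
time averages is harmonic, hence constant. -/
lemma IsAbsorbingClass.tendsto_of_bounded {C : Set (Orthant M)} (hC : IsAbsorbingClass P C)
    (hπ : IsStationary P π) {F : Orthant M → ℝ≥0∞} {K : ℝ≥0∞} (hK : K ≠ ∞)
    (hFK : ∀ n, F n ≤ K) (n : Orthant M) :
    Tendsto (fun t : ℕ => totalReward P F t n / t) atTop (𝓝 (expect π F)) := by
  refine tendsto_of_subseq_tendsto fun ns hns => ?_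
  -- `[0, ∞]^S` is sequentially compact, because `S` is countable.
  obtain ⟨h, -, φ, hφ, hlim⟩ := isCompact_univ.tendsto_subseq
    (x := fun i => fun m : Orthant M => totalReward P F (ns i) m / (ns i : ℝ≥0∞))
    fun _ => Set.mem_univ _
  rw [tendsto_pi_nhds] at hlim
  have hψ : Tendsto (fun i => ns (φ i)) atTop atTop := hns.comp hφ.tendsto_atTop
  have hhK : ∀ m, h m ≤ K := fun m =>
    le_of_tendsto' (hlim m) fun i => totalReward_div_le hFK _ _
  have hexp : ∀ p : PMF (Orthant M), Tendsto
      (fun i => expect p (fun m => totalReward P F (ns (φ i)) m / (ns (φ i) : ℝ≥0∞))) atTop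
      (𝓝 (expect p h)) := fun p =>
    tendsto_expect_of_bounded p hK (fun i m => totalReward_div_le hFK _ _) hlim
  have hstep : ∀ k m, expect (step P k m) F ≤ K := fun k m =>
    (expect_mono _ hFK).trans_eq (expect_const _ K)
  have hharm : ∀ m, expect (P m) h = h m := fun m => by
    have h1 := (hexp (P m)).add
      ((tendsto_div_natCast_zero (u := fun _ => F m) hK fun _ => hFK m).comp hψ)
    have h2 := (hlim m).add
      ((tendsto_div_natCast_zero (u := fun t => expect (step P t m) F) hK
        fun t => hstep t m).comp hψ)
    rw [add_zero] at h1 h2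
    refine tendsto_nhds_unique h1 (h2.congr fun i => ?_)
    simp only [Function.comp_apply, expect_div, ← ENNReal.add_div]
    rw [← totalReward_succ', totalReward_succ, add_comm]
  refine ⟨φ, ?_⟩
  have hmean : expect π h = expect π F := by
    refine tendsto_nhds_unique (hexp π) (tendsto_const_nhds.congr' ?_)
    filter_upwards [hψ.eventually_ne_atTop 0] with i hi
    exact (hπ.expect_totalReward_div F hi).symm
  rw [← hmean, ← hC.harmonic_eq hπ hK hhK hharm n]
  exact hlim n

/-- From every starting state, the lower time average of a nonnegative reward is at least its
stationary mean. From a transient state it may be larger, when the reward is unbounded. -/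
lemma IsAbsorbingClass.expect_le_liminf {C : Set (Orthant M)} (hC : IsAbsorbingClass P C)
    (hπ : IsStationary P π) (F : Orthant M → ℝ≥0∞) (n : Orthant M) :
    expect π F ≤ liminf (fun t : ℕ => totalReward P F t n / t) atTop := by
  have htrunc : ∀ K : ℕ, expect π (fun m => min (F m) K) ≤
      liminf (fun t : ℕ => totalReward P F t n / t) atTop := fun K => by
    rw [← (hC.tendsto_of_bounded hπ (ENNReal.natCast_ne_top K)
      (fun m => min_le_right (F m) _) n).liminf_eq]
    exact liminf_le_liminf (Eventually.of_forall fun t =>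
      ENNReal.div_le_div_right (totalReward_mono (fun m => min_le_left _ _) t n) _)
  have hF : ∀ m, liminf (fun K : ℕ => min (F m) (K : ℝ≥0∞)) atTop = F m := fun m => by
    have := (tendsto_const_nhds (x := F m)).min ENNReal.tendsto_nat_nhds_top
    rw [min_eq_left le_top] at this
    exact this.liminf_eq
  calc expect π F = expect π (fun m => liminf (fun K : ℕ => min (F m) (K : ℝ≥0∞)) atTop) := by
        simp only [hF]
    _ ≤ liminf (fun K : ℕ => expect π (fun m => min (F m) (K : ℝ≥0∞))) atTop :=
        expect_liminf_le π fun (K : ℕ) m => min (F m) (K : ℝ≥0∞)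
    _ ≤ liminf (fun _ : ℕ => liminf (fun t : ℕ => totalReward P F t n / t) atTop) atTop :=
        liminf_le_liminf (Eventually.of_forall htrunc)
    _ = _ := liminf_const _

/-- The ergodic theorem for integrable rewards, from the states that `π` charges. All time
averages have the same stationary mean, so that none of them can asymptotically exceed its
lower bound. -/
lemma IsAbsorbingClass.tendsto_of_ne_zero {C : Set (Orthant M)} (hC : IsAbsorbingClass P C)
    (hπ : IsStationary P π) {F : Orthant M → ℝ≥0∞} (hF : expect π F ≠ ∞) {n : Orthant M}
    (hn : π n ≠ 0) :
    Tendsto (fun t : ℕ => totalReward P F t n / t) atTop (𝓝 (expect π F)) := by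
  classical
  refine tendsto_of_le_liminf_of_limsup_le (hC.expect_le_liminf hπ F n) ?_
  set f : ℕ → Orthant M → ℝ≥0∞ := fun t m => totalReward P F t m / t with hf
  set rest : ℕ → ℝ≥0∞ := fun t => ∑' m, if m = n then 0 else π m * f t m with hrest
  have hsplit : ∀ t ≠ 0, π n * f t n + rest t = expect π F := fun t ht => by
    rw [← hπ.expect_totalReward_div F ht, expect, ENNReal.tsum_eq_add_tsum_ite n]
    simp only [hrest, hf]
    congr!
  have hβ : π n * expect π F + (∑' m, if m = n then 0 else π m * expect π F) = expect π F := by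
    conv_rhs => rw [← expect_const π (expect π F), expect, ENNReal.tsum_eq_add_tsum_ite n]
    congr!
  have hliminf : (∑' m, if m = n then 0 else π m * expect π F) ≤ liminf rest atTop := by
    refine le_trans (ENNReal.tsum_le_tsum fun m => ?_)
      (tsum_liminf_le fun t m => if m = n then 0 else π m * f t m)
    split_ifs with hm
    · exact zero_le
    · rw [ENNReal.liminf_const_mul_of_ne_top (π.apply_ne_top m)]
      exact mul_le_mul_right (hC.expect_le_liminf hπ F m) _
  have hlimsup : π n * limsup (fun t => f t n) atTop ≤ π n * expect π F := by
    rw [← ENNReal.limsup_const_mul_of_ne_top (π.apply_ne_top n)]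
    calc limsup (fun t => π n * f t n) atTop ≤ limsup (fun t => expect π F - rest t) atTop := by
          refine limsup_le_limsup ?_
          filter_upwards [eventually_ne_atTop 0] with t ht
          refine ENNReal.le_sub_of_add_le_right ?_ (hsplit t ht).le
          exact ne_top_of_le_ne_top hF ((hsplit t ht).symm ▸ le_add_self)
      _ = expect π F - liminf rest atTop := ENNReal.limsup_const_sub _ _ hF
      _ ≤ π n * expect π F := by
          rw [tsub_le_iff_right]
          calc expect π F = _ := hβ.symm
            _ ≤ _ := add_le_add_right hliminf _
  exact (ENNReal.mul_le_mul_iff_right hn (π.apply_ne_top n)).1 hlimsup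

/-! ### Nearest-neighbour walks: finite supports and real-valued rewards -/

lemma NearestNeighbour.support_step_finite (hP : NearestNeighbour P) (k : ℕ) (n : Orthant M) :
    (step P k n).support.Finite := by
  induction k generalizing n with
  | zero => simp [step]
  | succ k ih =>
    have hrow : (P n).support.Finite := by
      refine (Set.finite_Iic fun i => n i + 1).subset fun m hm i => ?_
      have := abs_le.1 (hP n m (pos_iff_ne_zero.2 hm) i)
      simp only
      omega
    rw [step, PMF.support_bind]
    exact hrow.biUnion fun l _ => ih l

lemma NearestNeighbour.support_finite (hP : NearestNeighbour P) (n : Orthant M) :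
    (P n).support.Finite := by
  simpa [step, PMF.bind_pure] using hP.support_step_finite 1 n

section FiniteSupport

variable {α : Type*} {p q : PMF α}

lemma expect_ne_top (hp : p.support.Finite) {h : α → ℝ≥0∞} (hh : ∀ m, h m ≠ ∞) :
    expect p h ≠ ∞ := by
  rw [expect, tsum_eq_sum (s := hp.toFinset)]
  · exact ENNReal.sum_ne_top.2 fun m _ => ENNReal.mul_ne_top (p.apply_ne_top m) (hh m)
  · intro m hm
    have : p m = 0 := by simpa [PMF.mem_support_iff] using hm
    rw [this, zero_mul]

lemma toReal_expect {h : α → ℝ≥0∞} (hh : ∀ m, h m ≠ ∞) :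
    (expect p h).toReal = ∑' m, (p m).toReal * (h m).toReal := by
  rw [expect, ENNReal.tsum_toReal_eq fun m => ENNReal.mul_ne_top (p.apply_ne_top m) (hh m)]
  simp only [ENNReal.toReal_mul]

lemma summable_toReal_mul (hp : p.support.Finite) (u : α → ℝ) :
    Summable fun m => (p m).toReal * u m := by
  refine summable_of_hasFiniteSupport (hp.subset fun m hm => ?_)
  intro hzero
  exact hm (by simp [hzero])

/-- Adding a constant to `u` does not change the difference of two expectations. -/
lemma tsum_sub_mul_sub (hp : p.support.Finite) (hq : q.support.Finite) (u : α → ℝ) (c : ℝ) :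
    ∑' m, ((q m).toReal - (p m).toReal) * (u m - c) =
      ∑' m, (q m).toReal * u m - ∑' m, (p m).toReal * u m := by
  have hone : ∀ r : PMF α, ∑' m, (r m).toReal * c = c := fun r => by
    rw [tsum_mul_right, ← ENNReal.tsum_toReal_eq r.apply_ne_top, r.tsum_coe, ENNReal.toReal_one,
      one_mul]
  have hu := (summable_toReal_mul hq u).sub (summable_toReal_mul hp u)
  have hc := (summable_toReal_mul hq fun _ => c).sub (summable_toReal_mul hp fun _ => c)
  calc ∑' m, ((q m).toReal - (p m).toReal) * (u m - c)
      = ∑' m, (((q m).toReal * u m - (p m).toReal * u m)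
          - ((q m).toReal * c - (p m).toReal * c)) := tsum_congr fun m => by ring
    _ = _ := by
        rw [hu.tsum_sub hc, (summable_toReal_mul hq u).tsum_sub (summable_toReal_mul hp u),
          (summable_toReal_mul hq fun _ => c).tsum_sub (summable_toReal_mul hp fun _ => c),
          hone, hone, sub_self, sub_zero]

end FiniteSupport

lemma NearestNeighbour.totalReward_ne_top (hP : NearestNeighbour P) (F : Orthant M → ℝ≥0)
    (t : ℕ) (n : Orthant M) : totalReward P (fun m => F m) t n ≠ ∞ :=
  ENNReal.sum_ne_top.2 fun k _ =>
    expect_ne_top (hP.support_step_finite k n) fun _ => ENNReal.coe_ne_top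

lemma NearestNeighbour.toReal_totalReward (hP : NearestNeighbour P) (F : Orthant M → ℝ≥0)
    (t : ℕ) (n : Orthant M) :
    (totalReward P (fun m => F m) t n).toReal = cumulativeReward P F t n := by
  rw [totalReward, ENNReal.toReal_sum fun k _ =>
    expect_ne_top (hP.support_step_finite k n) fun _ => ENNReal.coe_ne_top]
  refine Finset.sum_congr rfl fun k _ => ?_
  rw [toReal_expect fun _ => ENNReal.coe_ne_top]
  simp only [ENNReal.coe_toReal]

/-! ### Comparison of the two walks -/

/-- The bias terms enter the hypothesis of the error bound only through the defect of `F^t` in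
the reward recursion `F'^(t+1) = F' + P' F'^t` of the perturbed walk. -/
lemma defect_bounds (hP : NearestNeighbour P) (hP' : NearestNeighbour P')
    {F F' G : Orthant M → ℝ≥0} {n : Orthant M} {t : ℕ}
    (hG : |(F' n : ℝ) - (F n : ℝ) + ∑' n', ((P' n n').toReal - (P n n').toReal) * bias P F t n n'|
      ≤ (G n : ℝ)) :
    F' n + expect (P' n) (totalReward P (fun m => F m) t) ≤
        totalReward P (fun m => F m) (t + 1) n + G n ∧
      totalReward P (fun m => F m) (t + 1) n ≤
        F' n + expect (P' n) (totalReward P (fun m => F m) t) + G n := by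
  have hfin := hP.totalReward_ne_top F t
  have hq := expect_ne_top (hP'.support_finite n) hfin
  have hp := expect_ne_top (hP.support_finite n) hfin
  simp only [bias] at hG
  rw [tsum_sub_mul_sub (hP.support_finite n) (hP'.support_finite n)] at hG
  simp only [← hP.toReal_totalReward F t] at hG
  rw [← toReal_expect hfin, ← toReal_expect hfin, abs_le] at hG
  rw [totalReward_succ]
  constructor
  · rw [← ENNReal.toReal_le_toReal (by finiteness) (by finiteness),
      ENNReal.toReal_add (by finiteness) (by finiteness),
      ENNReal.toReal_add (by finiteness) (by finiteness),
      ENNReal.toReal_add (by finiteness) (by finiteness)]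
    simp only [ENNReal.coe_toReal]
    linarith [hG.2]
  · rw [← ENNReal.toReal_le_toReal (by finiteness) (by finiteness),
      ENNReal.toReal_add (by finiteness) (by finiteness),
      ENNReal.toReal_add (by finiteness) (by finiteness),
      ENNReal.toReal_add (by finiteness) (by finiteness)]
    simp only [ENNReal.coe_toReal]
    linarith [hG.1]

/-- If `u (t + 1) ≤ f + P u t + g`, and `u 0 = 0`, then `u t` is at most the total reward of `f`
plus that of `g`. -/
lemma le_totalReward_add {u : ℕ → Orthant M → ℝ≥0∞} {f g : Orthant M → ℝ≥0∞}
    (hzero : ∀ n, u 0 n = 0) (hsucc : ∀ t n, u (t + 1) n ≤ f n + expect (P n) (u t) + g n)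
    (t : ℕ) (n : Orthant M) : u t n ≤ totalReward P f t n + totalReward P g t n := by
  induction t generalizing n with
  | zero => simp [hzero]
  | succ t ih =>
    calc u (t + 1) n ≤ f n + expect (P n) (u t) + g n := hsucc t n
      _ ≤ f n + (expect (P n) (totalReward P f t) + expect (P n) (totalReward P g t)) + g n := by
          rw [← expect_add]
          gcongr
          exact expect_mono _ ih
      _ = _ := by
          rw [totalReward_succ, totalReward_succ]
          ring

/-- If `f + P u t ≤ u (t + 1) + g`, then the total reward of `f` is at most `u t` plus the total
reward of `g`. -/
lemma totalReward_le_add {u : ℕ → Orthant M → ℝ≥0∞} {f g : Orthant M → ℝ≥0∞}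
    (hsucc : ∀ t n, f n + expect (P n) (u t) ≤ u (t + 1) n + g n)
    (t : ℕ) (n : Orthant M) : totalReward P f t n ≤ u t n + totalReward P g t n := by
  induction t generalizing n with
  | zero => simp [totalReward]
  | succ t ih =>
    calc totalReward P f (t + 1) n = f n + expect (P n) (totalReward P f t) :=
          totalReward_succ _ _ _
      _ ≤ f n + (expect (P n) (u t) + expect (P n) (totalReward P g t)) := by
          rw [← expect_add]
          gcongr
          exact expect_mono _ ih
      _ ≤ u (t + 1) n + g n + expect (P n) (totalReward P g t) := by
          rw [← add_assoc]
          exact add_le_add (hsucc t n) le_rfl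
      _ = _ := by rw [totalReward_succ, add_assoc]

/-- The lower growth rate of a sequence with `P u t ≤ u (t + 1) + g` is superharmonic. -/
lemma expect_liminf_div_le {u : ℕ → Orthant M → ℝ≥0∞} {g : Orthant M → ℝ≥0∞}
    (hg : ∀ n, g n ≠ ∞) (hsucc : ∀ t n, expect (P n) (u t) ≤ u (t + 1) n + g n) (n : Orthant M) :
    expect (P n) (fun m => liminf (fun t : ℕ => u t m / t) atTop) ≤
      liminf (fun t : ℕ => u t n / t) atTop := by
  have hratio : Tendsto (fun t : ℕ => ((t + 1 : ℕ) : ℝ≥0∞) / t) atTop (𝓝 1) := by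
    have h := (tendsto_const_nhds (x := (1 : ℝ≥0∞))).add ENNReal.tendsto_inv_nat_nhds_zero
    rw [add_zero] at h
    refine h.congr' ?_
    filter_upwards [eventually_ne_atTop 0] with t ht
    rw [Nat.cast_succ, ENNReal.add_div,
      ENNReal.div_self (Nat.cast_ne_zero.2 ht) (ENNReal.natCast_ne_top t), one_div]
  calc expect (P n) (fun m => liminf (fun t : ℕ => u t m / t) atTop)
      ≤ liminf (fun t : ℕ => expect (P n) (fun m => u t m / t)) atTop :=
        expect_liminf_le (P n) fun (t : ℕ) m => u t m / t
    _ ≤ liminf ((fun t : ℕ => u (t + 1) n / t) + fun t : ℕ => g n / t) atTop := by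
        refine liminf_le_liminf (Eventually.of_forall fun t => ?_)
        simp only [Pi.add_apply, expect_div, ← ENNReal.add_div]
        exact ENNReal.div_le_div_right (hsucc t n) _
    _ = liminf (fun t : ℕ => u (t + 1) n / t) atTop :=
        ENNReal.liminf_add_of_right_tendsto_zero
          (tendsto_div_natCast_zero (u := fun _ => g n) (hg n) fun _ => le_rfl) _
    _ ≤ liminf ((fun t : ℕ => ((t + 1 : ℕ) : ℝ≥0∞) / t) *
          fun t : ℕ => u (t + 1) n / (t + 1 : ℕ)) atTop := by
        refine liminf_le_liminf (Eventually.of_forall fun t => le_of_eq ?_)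
        have h0 : ((t + 1 : ℕ) : ℝ≥0∞) ≠ 0 := Nat.cast_ne_zero.2 t.succ_ne_zero
        have htop := ENNReal.natCast_ne_top (t + 1)
        simp only [Pi.mul_apply]
        rw [mul_comm, ← mul_div_assoc, ENNReal.div_mul_cancel h0 htop]
    _ ≤ limsup (fun t : ℕ => ((t + 1 : ℕ) : ℝ≥0∞) / t) atTop *
          liminf (fun t : ℕ => u (t + 1) n / (t + 1 : ℕ)) atTop := by
        refine ENNReal.liminf_mul_le ?_ ?_ <;> rw [hratio.limsup_eq] <;> simp
    _ = liminf (fun t : ℕ => u t n / t) atTop := by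
        rw [hratio.limsup_eq, one_mul, liminf_nat_add (fun t : ℕ => u t n / (t : ℝ≥0∞)) 1]

lemma liminf_add_le_of_tendsto {f g : ℕ → ℝ≥0∞} {c : ℝ≥0∞} (hc : c ≠ ∞)
    (hg : Tendsto g atTop (𝓝 c)) :
    liminf (fun t => f t + g t) atTop ≤ liminf f atTop + c := by
  have hzero : Tendsto (fun t => g t - c) atTop (𝓝 0) := by
    simpa using ENNReal.Tendsto.sub hg (tendsto_const_nhds (x := c)) (Or.inr hc)
  calc liminf (fun t => f t + g t) atTop
      ≤ liminf ((fun t => f t + c) + fun t => g t - c) atTop := by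
        refine liminf_le_liminf (Eventually.of_forall fun t => ?_)
        simp only [Pi.add_apply, add_assoc]
        gcongr
        exact le_add_tsub
    _ = liminf (fun t => f t + c) atTop := ENNReal.liminf_add_of_right_tendsto_zero hzero _
    _ = liminf f atTop + c :=
        liminf_add_const _ _ _ (by isBoundedDefault) (by isBoundedDefault)

end RandomWalk

/-- Error bound of the Markov reward approach. `P`, `π`, `F` belong to the walk `R`, and `P'`,
`π'`, `F'` to the perturbed walk `R̄`. The first two conclusions say `|𝓕̄ - 𝓕| ≤ ∑ n, π̄(n) G(n)`
in `[0, ∞]`; the third spells this out for real numbers. -/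
theorem theorem1 (M : ℕ)
    (P P' : Orthant M → PMF (Orthant M))
    (hP : RandomWalk.NearestNeighbour P) (hP' : RandomWalk.NearestNeighbour P')
    (hC : RandomWalk.HasSingleAbsorbingClass P) (hC' : RandomWalk.HasSingleAbsorbingClass P')
    (π π' : PMF (Orthant M))
    (hπ : RandomWalk.IsStationary P π) (hπ' : RandomWalk.IsStationary P' π')
    (F F' G : Orthant M → ℝ≥0)
    (hG : ∀ (n : Orthant M) (t : ℕ),
      |(F' n : ℝ) - (F n : ℝ)
        + ∑' n', ((P' n n').toReal - (P n n').toReal) * RandomWalk.bias P F t n n'|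
        ≤ (G n : ℝ)) :
    RandomWalk.performance π' F' ≤ RandomWalk.performance π F + RandomWalk.performance π' G ∧
    RandomWalk.performance π F ≤ RandomWalk.performance π' F' + RandomWalk.performance π' G ∧
    (RandomWalk.performance π' G ≠ ∞ →
      (RandomWalk.performance π F ≠ ∞ ↔ RandomWalk.performance π' F' ≠ ∞) ∧
      (RandomWalk.performance π F ≠ ∞ →
        |(RandomWalk.performance π' F').toReal - (RandomWalk.performance π F).toReal|
          ≤ (RandomWalk.performance π' G).toReal)) := by
  -- The inequalities are proved in `[0, ∞]`; it remains to read them in `ℝ`.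
  suffices h : RandomWalk.performance π' F' ≤
        RandomWalk.performance π F + RandomWalk.performance π' G ∧
      RandomWalk.performance π F ≤
        RandomWalk.performance π' F' + RandomWalk.performance π' G by
    refine ⟨h.1, h.2, fun hGfin => ?_⟩
    have hiff : RandomWalk.performance π F ≠ ∞ ↔ RandomWalk.performance π' F' ≠ ∞ :=
      ⟨fun hF => ne_top_of_le_ne_top (ENNReal.add_ne_top.2 ⟨hF, hGfin⟩) h.1,
        fun hF' => ne_top_of_le_ne_top (ENNReal.add_ne_top.2 ⟨hF', hGfin⟩) h.2⟩
    refine ⟨hiff, fun hF => ?_⟩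
    have hF' := hiff.1 hF
    have h1 := ENNReal.toReal_mono (ENNReal.add_ne_top.2 ⟨hF, hGfin⟩) h.1
    have h2 := ENNReal.toReal_mono (ENNReal.add_ne_top.2 ⟨hF', hGfin⟩) h.2
    rw [ENNReal.toReal_add hF hGfin] at h1
    rw [ENNReal.toReal_add hF' hGfin] at h2
    rw [abs_le]
    constructor <;> linarith
  obtain ⟨C, hC⟩ := hC
  obtain ⟨C', hC'⟩ := hC'
  have hdef := fun (t : ℕ) n => RandomWalk.defect_bounds hP hP' (hG n t)
  obtain ⟨a, ha, hπa⟩ := hC'.exists_mem_ne_zero hπ'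
  constructor
  · by_cases hfin : RandomWalk.performance π F ≠ ∞ ∧ RandomWalk.performance π' G ≠ ∞
    swap
    · rw [not_and_or, not_not, not_not] at hfin
      rcases hfin with h | h <;> simp [h]
    obtain ⟨hF, hGfin⟩ := hfin
    obtain ⟨c, hc⟩ := π.support_nonempty
    -- `a` may be transient for `R`; its lower growth rate of `F^t` is compared, through the
    -- perturbed walk, with that of a state `c` in the support of `π`.
    have hgrowth : liminf (fun t : ℕ => RandomWalk.totalReward P (fun m => F m) t a / t) atTop ≤
        RandomWalk.performance π F := by
      refine (hC'.superharmonic_le hπ'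
        (RandomWalk.expect_liminf_div_le (g := fun n => G n) (fun _ => ENNReal.coe_ne_top)
          fun t n => le_add_self.trans (hdef t n).1) ha c).trans ?_
      exact (hC.tendsto_of_ne_zero hπ hF hc).liminf_eq.le
    calc RandomWalk.performance π' F'
        ≤ liminf (fun t : ℕ => RandomWalk.totalReward P' (fun m => F' m) t a / t) atTop :=
          hC'.expect_le_liminf hπ' _ a
      _ ≤ liminf (fun t : ℕ => RandomWalk.totalReward P (fun m => F m) t a / t +
            RandomWalk.totalReward P' (fun m => G m) t a / t) atTop := by
          refine liminf_le_liminf (Eventually.of_forall fun t => ?_)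
          simp only [← ENNReal.add_div]
          exact ENNReal.div_le_div_right
            (RandomWalk.totalReward_le_add (fun t n => (hdef t n).1) t a) _
      _ ≤ liminf (fun t : ℕ => RandomWalk.totalReward P (fun m => F m) t a / t) atTop +
            RandomWalk.performance π' G :=
          RandomWalk.liminf_add_le_of_tendsto hGfin (hC'.tendsto_of_ne_zero hπ' hGfin hπa)
      _ ≤ _ := add_le_add hgrowth le_rfl
  · by_cases hfin : RandomWalk.performance π' F' ≠ ∞ ∧ RandomWalk.performance π' G ≠ ∞
    swap
    · rw [not_and_or, not_not, not_not] at hfin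
      rcases hfin with h | h <;> simp [h]
    obtain ⟨hF', hGfin⟩ := hfin
    calc RandomWalk.performance π F
        ≤ liminf (fun t : ℕ => RandomWalk.totalReward P (fun m => F m) t a / t) atTop :=
          hC.expect_le_liminf hπ _ a
      _ ≤ liminf (fun t : ℕ => RandomWalk.totalReward P' (fun m => F' m) t a / t +
            RandomWalk.totalReward P' (fun m => G m) t a / t) atTop := by
          refine liminf_le_liminf (Eventually.of_forall fun t => ?_)
          simp only [← ENNReal.add_div]
          exact ENNReal.div_le_div_right (RandomWalk.le_totalReward_add
            (fun n => by simp [RandomWalk.totalReward]) (fun t n => (hdef t n).2) t a) _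
      _ = _ := ((hC'.tendsto_of_ne_zero hπ' hF' hπa).add
          (hC'.tendsto_of_ne_zero hπ' hGfin hπa)).liminf_eq
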